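/- Let $M=(m_{ij})_{i,j\in I}$ be a right-angled Coxeter matrix over a finite index set $I$ (that is, $m_{ij}\in\{2,\infty\}$ for all $i\neq j$), and let $\Delta$ be a semiregular building of type $M$ with parameters $(q_i)_{i\in I}$, viewed as a chamber system: every $i$-panel has the same, possibly infinite, cardinality $q_i\ge 2$. For each $i\in I$ let $X_i$ be a set with $|X_i|=q_i$, and let $\lambda=(\lambda_i)_{i\in I}\colon\Delta\to\prod_{i\in I}X_i$ be a legal colouring, i.e. on every $i$-panel $\lambda_i$ restricts to a bijection onto $X_i$ and $\lambda_j$ is constant for every $j\ne i$. For each $i\in I$ let $F_i\le\mathrm{Sym}(X_i)$ be a permutation group. Let $$U_\Delta(\boldsymbol F)=\{g\in\mathrm{Aut}(\Delta)\mid \lambda_i|_{g\mathcal P}\circ g|_{\mathcal P}\circ(\lambda_i|_{\mathcal P})^{-1}\in F_i\text{ for every } i\in I\text{ and every } i\text{-panel }\mathcal P\}$$ be the universal group, where $\mathrm{Aut}(\Delta)$ is the group of type-preserving automorphisms of $\Delta$, and let $U_\Delta(\boldsymbol F)^+$ be the subgroup of $U_\Delta(\boldsymbol F)$ generated by the stabilisers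 in $U_\Delta(\boldsymbol F)$ of all chambers. For each $i\in I$ let $\equiv_i$ be the equivalence relation on $X_i$ whose classes are the orbits of $F_i$, and let $I'$ be the set of those $i\in I$ for which $\equiv_i$ is not the universal relation. Let $(\tau,\Delta')$ be an implosion of $\Delta$ with respect to the relations $\equiv_i$; that is, $\Delta'$ is a semiregular right-angled building over $I'$ whose diagram is induced by that of $\Delta$, with parameters $q'_i=|X_i/{\equiv_i}|$ for $i\in I'$, equipped with a legal colouring $\lambda'$ with colour sets $X_i/{\equiv_i}$, and $\tau\colon\Delta\to\Delta'$ is a surjective map such that $\lambda'_i(\tau(c))=[\lambda_i(c)]_i$ for all chambers $c$ of $\Delta$ and all $i\in I'$, and $\mathrm{dist}_{\Delta'}(\tau(c_1),\tau(c_2))\le\mathrm{dist}_\Delta(c_1,c_2)$ (gallery distances) for all chambers $c_1,c_2$ of $\Delta$. Then $U_\Delta(\boldsymbol F)^+$ stabilises every fibre of $\tau$: for every $g\in U_\Delta(\boldsymbol F)^+$ and every chamber $y$ of $\Delta'$, $g(\tau^{-1}(y))=\tau^{-1}(y)$. -/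

import Mathlib

/-- A chamber system over `I` with chamber set `C`: for every `i`, the equivalence relation
of `i`-adjacency. -/
structure ChamberSystem (I : Type*) (C : Type*) where
  adj : I → Setoid C

/-- The Coxeter diagram is right-angled; Mathlib encodes `m_{ij} = ∞` by `M i j = 0`. -/
def CoxeterMatrix.IsRightAngled {I : Type*} (M : CoxeterMatrix I) : Prop :=
  ∀ i j, i ≠ j → M i j = 2 ∨ M i j = 0

/-- The Coxeter diagram induced on a subset of the index set. -/
def CoxeterMatrix.induced {I : Type*} (M : CoxeterMatrix I) (p : I → Prop) :
    CoxeterMatrix {i // p i} where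
  M := fun i j => M i.1 j.1
  isSymm := by
    ext i j
    exact M.symmetric j.1 i.1
  diagonal := fun i => M.diagonal i.1
  off_diagonal := fun i j h => M.off_diagonal i.1 j.1 (fun e => h (Subtype.ext e))

namespace ChamberSystem

variable {I C : Type*}

/-- The `i`-panel containing the chamber `c`. -/
def panel (Δ : ChamberSystem I C) (i : I) (c : C) : Set C := {d | (Δ.adj i).r c d}

/-- `Δ.Joined f c d`: there is a (non-stammering) gallery of type `f` from `c` to `d`. -/
def Joined (Δ : ChamberSystem I C) : List I → C → C → Prop
  | [], c, d => c = d
  | i :: f, c, d => ∃ e, c ≠ e ∧ (Δ.adj i).r c e ∧ Δ.Joined f e d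

/-- `Δ` is a building of type `M`: every panel has at least two chambers, and there is a distance
function with values in the Coxeter group `W` of type `M` such that, for every reduced word `f`,
`δ c d` is the element of `W` represented by `f` if and only if `c` and `d` are joined by a gallery
of type `f`. -/
structure IsBuilding (Δ : ChamberSystem I C) (M : CoxeterMatrix I) : Prop where
  nonempty : Nonempty C
  two_le_panel : ∀ i c, ∃ d, d ≠ c ∧ (Δ.adj i).r c d
  exists_weylDist : ∃ δ : C → C → M.Group, ∀ f : List I, M.toCoxeterSystem.IsReduced f →
    ∀ c d, δ c d = M.toCoxeterSystem.wordProd f ↔ Δ.Joined f c d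

/-- `Δ` is semiregular with parameters `q_i = |X i| ≥ 2`. -/
def IsSemiregular (Δ : ChamberSystem I C) (X : I → Type*) : Prop :=
  ∀ i, Nontrivial (X i) ∧ ∀ c, Nonempty (Δ.panel i c ≃ X i)

/-- The graph on the chambers whose edges join distinct adjacent chambers. Its (extended) graph
distance is the gallery distance. -/
def graph (Δ : ChamberSystem I C) : SimpleGraph C where
  Adj c d := c ≠ d ∧ ∃ i, (Δ.adj i).r c d
  symm := ⟨fun _ _ h => ⟨h.1.symm, h.2.imp fun i hi => (Δ.adj i).iseqv.symm hi⟩⟩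
  loopless := ⟨fun _ h => h.1 rfl⟩

/-- The group of (type-preserving) automorphisms of `Δ`. -/
def Aut (Δ : ChamberSystem I C) : Subgroup (Equiv.Perm C) where
  carrier := {g | ∀ i c d, (Δ.adj i).r (g c) (g d) ↔ (Δ.adj i).r c d}
  one_mem' := fun _ _ _ => Iff.rfl
  mul_mem' := fun {g h} hg hh i c d => (hg i (h c) (h d)).trans (hh i c d)
  inv_mem' := fun {g} hg i c d => by
    have := hg i (g⁻¹ c) (g⁻¹ d)
    simpa using this.symm

/-- A legal colouring `λ : C → ∏ i, X i` of `Δ`; `colour i` is its `i`-th component `λ_i`. -/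
structure LegalColouring (Δ : ChamberSystem I C) (X : I → Type*) where
  colour : ∀ i, C → X i
  bijective : ∀ i c, Function.Bijective (fun d : Δ.panel i c => colour i d.1)
  constant : ∀ i j, j ≠ i → ∀ c d, (Δ.adj i).r c d → colour j c = colour j d

/-- The bijection `g|_P : P → g P`, where `P` is the `i`-panel of `c`. -/
def panelMap (Δ : ChamberSystem I C) (g : Δ.Aut) (i : I) (c : C) :
    Δ.panel i c ≃ Δ.panel i (g.1 c) :=
  g.1.subtypeEquiv fun d => (g.2 i c d).symm

namespace LegalColouring

variable {Δ : ChamberSystem I C} {X : I → Type*}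

/-- The bijection `λ_i|_P : P → X i`, where `P` is the `i`-panel of `c`. -/
noncomputable def panelEquiv (l : LegalColouring Δ X) (i : I) (c : C) : Δ.panel i c ≃ X i :=
  Equiv.ofBijective _ (l.bijective i c)

/-- The local action `λ_i|_{gP} ∘ g|_P ∘ (λ_i|_P)⁻¹` of `g` at the `i`-panel `P` of `c`. -/
noncomputable def localAction (l : LegalColouring Δ X) (g : Δ.Aut) (i : I) (c : C) :
    Equiv.Perm (X i) :=
  ((l.panelEquiv i c).symm.trans (Δ.panelMap g i c)).trans (l.panelEquiv i (g.1 c))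

theorem localAction_colour (l : LegalColouring Δ X) (g : Δ.Aut) (i : I) (c d : C)
    (h : (Δ.adj i).r c d) : l.localAction g i c (l.colour i d) = l.colour i (g.1 d) := by
  have h1 : l.panelEquiv i c ⟨d, h⟩ = l.colour i d := rfl
  rw [← h1]
  simp only [localAction, Equiv.trans_apply, Equiv.symm_apply_apply]
  rfl

theorem exists_colour (l : LegalColouring Δ X) (i : I) (c : C) (x : X i) :
    ∃ d, (Δ.adj i).r c d ∧ l.colour i d = x := by
  obtain ⟨⟨d, hd⟩, h⟩ := (l.bijective i c).2 x
  exact ⟨d, hd, h⟩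

theorem localAction_one (l : LegalColouring Δ X) (i : I) (c : C) :
    l.localAction 1 i c = 1 := by
  ext x
  obtain ⟨d, hd, rfl⟩ := l.exists_colour i c x
  exact l.localAction_colour 1 i c d hd

theorem localAction_mul (l : LegalColouring Δ X) (g h : Δ.Aut) (i : I) (c : C) :
    l.localAction (g * h) i c = l.localAction g i (h.1 c) * l.localAction h i c := by
  ext x
  obtain ⟨d, hd, rfl⟩ := l.exists_colour i c x
  rw [Equiv.Perm.mul_apply, l.localAction_colour h i c d hd, l.localAction_colour _ i c d hd,
    l.localAction_colour g i _ _ ((h.2 i c d).2 hd)]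
  rfl

theorem localAction_inv (l : LegalColouring Δ X) (g : Δ.Aut) (i : I) (c : C) :
    l.localAction g⁻¹ i c = (l.localAction g i (g⁻¹.1 c))⁻¹ := by
  have h := l.localAction_mul g g⁻¹ i c
  rw [mul_inv_cancel, localAction_one] at h
  exact (inv_eq_of_mul_eq_one_right h.symm).symm

/-- The universal group `U_Δ^λ(F)`: the automorphisms all of whose local actions at `i`-panels
lie in `F i`, for every `i`. -/
noncomputable def universalGroup (l : LegalColouring Δ X) (F : ∀ i, Subgroup (Equiv.Perm (X i))) :
    Subgroup Δ.Aut where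
  carrier := {g | ∀ i c, l.localAction g i c ∈ F i}
  one_mem' := fun i c => by
    rw [localAction_one]
    exact (F i).one_mem
  mul_mem' := fun {g h} hg hh i c => by
    rw [localAction_mul]
    exact (F i).mul_mem (hg i _) (hh i c)
  inv_mem' := fun {g} hg i c => by
    rw [localAction_inv]
    exact (F i).inv_mem (hg i _)

/-- The subgroup `U_Δ^λ(F)⁺` of `U_Δ^λ(F)` generated by the stabilisers in `U_Δ^λ(F)` of
all chambers. -/
noncomputable def universalGroupPlus (l : LegalColouring Δ X)
    (F : ∀ i, Subgroup (Equiv.Perm (X i))) : Subgroup Δ.Aut :=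
  ⨆ c : C, l.universalGroup F ⊓ MulAction.stabilizer Δ.Aut c

end LegalColouring

/-- The index `i` belongs to `I'`, i.e. the relation `≡_i` is not the universal relation. -/
def NotUniversal {X : I → Type*} (r : ∀ i, Setoid (X i)) (i : I) : Prop :=
  ¬ ∀ x y : X i, (r i).r x y

/-- `(τ, Δ')` is an implosion of `Δ` (of type `M`, with legal colouring `l`) with respect to the
equivalence relations `r i`: `Δ'` is a semiregular building over `I'` whose diagram is induced by
`M`, with parameters `|X i / r i|` and legal colouring `l'` by the quotient sets `X i / r i`, and
`τ : Δ → Δ'` is surjective, compatible with the colourings, and nonexpansive for the gallery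
distances. -/
structure IsImplosion {C' : Type*} {X : I → Type*} (M : CoxeterMatrix I)
    (Δ : ChamberSystem I C) (l : LegalColouring Δ X) (r : ∀ i, Setoid (X i))
    (Δ' : ChamberSystem {i // NotUniversal r i} C')
    (l' : LegalColouring Δ' (fun i => Quotient (r i.1))) (τ : C → C') : Prop where
  isBuilding : Δ'.IsBuilding (M.induced (NotUniversal r))
  isSemiregular : Δ'.IsSemiregular (fun i => Quotient (r i.1))
  surjective : Function.Surjective τ
  colour_eq : ∀ (i : {i // NotUniversal r i}) (c : C),
    l'.colour i (τ c) = Quotient.mk (r i.1) (l.colour i.1 c)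
  nonexpansive : ∀ c d : C, Δ'.graph.edist (τ c) (τ d) ≤ Δ.graph.edist c d

end ChamberSystem

/-! The point is that `τ` is rigid along galleries. Nonexpansiveness puts the images of `i`-adjacent
chambers at distance at most one, and compatibility with the legal colourings leaves only equality
or `i`-adjacency (`eq_or_adj`). So the image of a neighbour is forced by the image of the chamber
and the class of the neighbour's `i`-colour (`eq_of_adj`). An element `g` of the universal group
moves `i`-colours only within `F i`-orbits; hence `τ ∘ g` and `τ`, once equal at one chamber, agree
everywhere by connectedness. For a chamber stabiliser they agree at the fixed chamber, and
invariance of `τ` passes to products. -/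

namespace ChamberSystem

variable {I C : Type*}

/-- Any two chambers of a building are joined by a gallery. -/
theorem IsBuilding.exists_joined {Δ : ChamberSystem I C} {M : CoxeterMatrix I}
    (h : Δ.IsBuilding M) (c d : C) : ∃ f, Δ.Joined f c d := by
  obtain ⟨δ, hδ⟩ := h.exists_weylDist
  obtain ⟨f, hf, hw⟩ := M.toCoxeterSystem.exists_isReduced (δ c d)
  exact ⟨f, (hδ f hf c d).1 hw⟩

/-- Adjacent chambers are at gallery distance at most one. -/
theorem edist_le_one_of_adj {Δ : ChamberSystem I C} {i : I} {c d : C} (h : (Δ.adj i).r c d) :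
    Δ.graph.edist c d ≤ 1 := by
  rw [SimpleGraph.edist_le_one_iff_adj_or_eq]
  by_cases hcd : c = d
  · exact Or.inr hcd
  · exact Or.inl ⟨hcd, i, h⟩

/-- Two `i`-adjacent chambers with the same `i`-colour coincide. -/
theorem LegalColouring.eq_of_adj {Δ : ChamberSystem I C} {X : I → Type*}
    (l : LegalColouring Δ X) {i : I} {c d : C} (h : (Δ.adj i).r c d)
    (hc : l.colour i c = l.colour i d) : c = d :=
  congrArg Subtype.val <|
    (l.bijective i c).1 (a₁ := ⟨c, (Δ.adj i).iseqv.refl c⟩) (a₂ := ⟨d, h⟩) hc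

namespace IsImplosion

variable {C' : Type*} {X : I → Type*} {M : CoxeterMatrix I} {Δ : ChamberSystem I C}
  {l : LegalColouring Δ X} {r : ∀ i, Setoid (X i)} {Δ' : ChamberSystem {i // NotUniversal r i} C'}
  {l' : LegalColouring Δ' (fun i => Quotient (r i.1))} {τ : C → C'}

/-- An implosion maps `i`-adjacent chambers to equal chambers, or to `i`-adjacent chambers. -/
theorem eq_or_adj (h : IsImplosion M Δ l r Δ' l' τ) {i : I} {c d : C} (hcd : (Δ.adj i).r c d) :
    τ c = τ d ∨ ∃ hi : NotUniversal r i, (Δ'.adj ⟨i, hi⟩).r (τ c) (τ d) := by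
  have h1 := (h.nonexpansive c d).trans (edist_le_one_of_adj hcd)
  rw [SimpleGraph.edist_le_one_iff_adj_or_eq] at h1
  obtain ⟨-, j, hj⟩ | h1 := h1
  · by_cases hji : j.1 = i
    · subst hji
      exact Or.inr ⟨j.2, hj⟩
    -- For `j ≠ i` the colour `λ_j` is constant on `i`-panels, so the `j`-adjacent images share
    -- their `j`-colour and coincide.
    · refine Or.inl (l'.eq_of_adj hj ?_)
      rw [h.colour_eq, h.colour_eq, l.constant i j.1 hji c d hcd]
  · exact Or.inl h1

/-- The image of a chamber under an implosion is determined by the image of any `i`-adjacent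
chamber together with the class of its `i`-colour. -/
theorem eq_of_adj (h : IsImplosion M Δ l r Δ' l' τ) {i : I} {c d c₁ d₁ : C}
    (hcd : (Δ.adj i).r c d) (hcd₁ : (Δ.adj i).r c₁ d₁) (hc : τ c = τ c₁)
    (hd : (r i).r (l.colour i d) (l.colour i d₁)) : τ d = τ d₁ := by
  by_cases hi : NotUniversal r i
  · have adj : ∀ {a b}, (Δ.adj i).r a b → (Δ'.adj ⟨i, hi⟩).r (τ a) (τ b) := fun {a b} hab => by
      obtain e | ⟨_, e⟩ := h.eq_or_adj hab
      · rw [e]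
      · exact e
    -- Both images lie in the `i`-panel of `τ c = τ c₁`, where the colour class singles out one
    -- chamber.
    refine l'.eq_of_adj ((Δ'.adj _).iseqv.trans ((Δ'.adj _).iseqv.symm (adj hcd)) ?_) ?_
    · rw [hc]
      exact adj hcd₁
    · rw [h.colour_eq, h.colour_eq]
      exact Quotient.sound hd
  -- For `i ∉ I'` there is no `i`-adjacency in `Δ'`, so each `i`-panel collapses to a single
  -- chamber.
  · have eq : ∀ {a b}, (Δ.adj i).r a b → τ a = τ b := fun hab =>
      (h.eq_or_adj hab).resolve_right fun ⟨hi', _⟩ => hi hi'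
    rw [← eq hcd, hc, eq hcd₁]

end IsImplosion

/-- The local actions preserve the orbits of `F i` on the `i`-colours. -/
theorem LegalColouring.orbitRel_colour {Δ : ChamberSystem I C} {X : I → Type*}
    {l : LegalColouring Δ X} {F : ∀ i, Subgroup (Equiv.Perm (X i))} {g : Δ.Aut}
    (hg : g ∈ l.universalGroup F) (i : I) (c : C) :
    (MulAction.orbitRel (F i) (X i)).r (l.colour i (g.1 c)) (l.colour i c) :=
  ⟨⟨l.localAction g i c, hg i c⟩, l.localAction_colour g i c c ((Δ.adj i).iseqv.refl c)⟩

namespace IsImplosion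

variable {C' : Type*} {X : I → Type*} {M : CoxeterMatrix I} {Δ : ChamberSystem I C}
  {l : LegalColouring Δ X} {F : ∀ i, Subgroup (Equiv.Perm (X i))}
  {Δ' : ChamberSystem {i // NotUniversal (fun j => MulAction.orbitRel (F j) (X j)) i} C'}
  {l' : LegalColouring Δ' (fun i => Quotient (MulAction.orbitRel (F i.1) (X i.1)))} {τ : C → C'}

/-- Each gallery step `c, e` is compared with its translate `g c, g e`: the starting images agree,
and the `i`-colours of `e` and `g e` lie in one `F i`-orbit. -/
theorem apply_eq_of_joined
    (h : IsImplosion M Δ l (fun j => MulAction.orbitRel (F j) (X j)) Δ' l' τ) {g : Δ.Aut}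
    (hg : g ∈ l.universalGroup F) (f : List I) {c d : C} (hf : Δ.Joined f c d)
    (hc : τ (g.1 c) = τ c) : τ (g.1 d) = τ d := by
  induction f generalizing c with
  | nil => exact (show c = d from hf) ▸ hc
  | cons i f ih =>
    obtain ⟨e, -, hce, hed⟩ := hf
    exact ih hed (h.eq_of_adj ((g.2 i c e).2 hce) hce hc (LegalColouring.orbitRel_colour hg i e))

/-- The elements of `U(F)⁺` preserve the value of an implosion. -/
theorem apply_smul (h : IsImplosion M Δ l (fun j => MulAction.orbitRel (F j) (X j)) Δ' l' τ)
    (hΔ : Δ.IsBuilding M) {g : Δ.Aut} (hg : g ∈ l.universalGroupPlus F) (d : C) :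
    τ (g • d) = τ d := by
  induction hg using Subgroup.iSup_induction' generalizing d with
  | hp c g hg =>
    obtain ⟨f, hf⟩ := hΔ.exists_joined c d
    -- The base of the propagation is the fixed chamber: `g • c = c`.
    exact h.apply_eq_of_joined hg.1 f hf (congrArg τ hg.2)
  | h1 => rw [one_smul]
  | hmul g₁ g₂ _ _ h₁ h₂ => rw [mul_smul, h₁, h₂]

end IsImplosion

end ChamberSystem

theorem mainTheorem10 {I : Type*} [Finite I] {C C' : Type*} {X : I → Type*}
    (M : CoxeterMatrix I) (hM : M.IsRightAngled)
    (Δ : ChamberSystem I C) (hΔ : Δ.IsBuilding M) (hq : Δ.IsSemiregular X)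
    (l : ChamberSystem.LegalColouring Δ X)
    (F : ∀ i, Subgroup (Equiv.Perm (X i)))
    (Δ' : ChamberSystem
      {i // ChamberSystem.NotUniversal (fun j => MulAction.orbitRel (F j) (X j)) i} C')
    (l' : ChamberSystem.LegalColouring Δ'
      (fun i => Quotient (MulAction.orbitRel (F i.1) (X i.1))))
    (τ : C → C')
    (hτ : ChamberSystem.IsImplosion M Δ l (fun j => MulAction.orbitRel (F j) (X j)) Δ' l' τ) :
    ∀ g ∈ l.universalGroupPlus F, ∀ y : C',
      (fun c => g • c) '' (τ ⁻¹' {y}) = τ ⁻¹' {y} := by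
  intro g hg y
  ext d
  constructor
  · rintro ⟨c, hc, rfl⟩
    exact (hτ.apply_smul hΔ hg c).trans hc
  -- Invariance under `g⁻¹` turns inclusion of the translated fibre into equality.
  · intro hd
    exact ⟨g⁻¹ • d, (hτ.apply_smul hΔ (inv_mem hg) d).trans hd, smul_inv_smul g d⟩
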